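/- An SR (stable roommates) instance $I=(A,\succ)$ consists of a finite set $A$ of $n$ agents and, for each agent $i\in A$, a strict linear order $\succ_i$ on $A\setminus\{i\}$; by convention each agent ranks itself below all other agents. A stable partition of $I$ is a permutation $\Pi$ of $A$ such that (T1) for every $i$, either $\Pi(i)=\Pi^{-1}(i)$ or $\Pi(i)\succ_i\Pi^{-1}(i)$, and (T2) there are no $i\ne j$ with $j\succ_i\Pi^{-1}(i)$ and $i\succ_j\Pi^{-1}(j)$. A reduced stable cycle of $I$ is a cycle of length $2$ or of odd length (fixed points being cycles of length $1$) of some stable partition of $I$; let $\mathcal{RSC}$ be the set of reduced stable cycles. For a stable partition $\Pi$ of $I$ let $\mathcal O_I$ be the set of its cycles of odd length, and let $I_T$ be the following instance with possibly incomplete preference lists (SRI instance). Its agents are the agents of $I$ that lie in no cycle of $\mathcal O_I$. Two distinct agents $j,k$ of $I_T$ are mutually acceptable unless there is an agent $i$ in a cycle of $\mathcal O_I$ such that $j\succ_i\Pi^{-1}(i)$ and $i\succ_j k$, or such that $k\succ_i\Pi^{-1}(i)$ and $i\succ_k j$. Preferences among acceptable agents are those of $I$. A matching of $I_T$ is a set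 of disjoint mutually acceptable pairs; it is stable if there is no mutually acceptable pair in which each agent is unmatched or strictly prefers the other agent to its partner. Let $\mathcal{SP}(I_T)$ be the set of stable pairs of $I_T$, i.e. the pairs that belong to at least one stable matching of $I_T$. **Theorem.** Let $I$ be an SR instance with $n\ge 2$ agents. Then $$1\le|\mathcal{RSC}|\le\frac{n(n-1)}{2}+1,$$ and for every stable partition $\Pi$ of $I$, with $\mathcal O_I$ and $I_T$ formed from $\Pi$ as above, $$|\mathcal{RSC}|=|\mathcal O_I|+|\mathcal{SP}(I_T)|.$$ -/

import Mathlib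

/-- A stable roommates instance with (possibly) incomplete strict preference lists on the set of
agents `A`. The edges of `acceptable` are the mutually acceptable pairs, and `prefers i j k` says
that agent `i` ranks `j` strictly better than `k`. Each `prefers i` is a strict linear order on the
agents that are acceptable to `i`. -/
structure SRIInstance (A : Type*) where
  acceptable : SimpleGraph A
  prefers : A → A → A → Prop
  prefers_left : ∀ i j k, prefers i j k → acceptable.Adj i j
  prefers_right : ∀ i j k, prefers i j k → acceptable.Adj i k
  prefers_irrefl : ∀ i j, ¬ prefers i j j
  prefers_trans : ∀ i j k l, prefers i j k → prefers i k l → prefers i j l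
  prefers_total : ∀ i j k, acceptable.Adj i j → acceptable.Adj i k → j ≠ k →
    prefers i j k ∨ prefers i k j

namespace SRIInstance

variable {A : Type*}

/-- Two mutually acceptable agents block the matching `M` if each of them is unassigned in `M` or
strictly prefers the other one to its partner in `M`. -/
def Blocks (J : SRIInstance A) (M : J.acceptable.Subgraph) (i j : A) : Prop :=
  J.acceptable.Adj i j ∧
    (i ∉ M.verts ∨ ∃ k, M.Adj i k ∧ J.prefers i j k) ∧
    (j ∉ M.verts ∨ ∃ k, M.Adj j k ∧ J.prefers j i k)

def IsStableMatching (J : SRIInstance A) (M : J.acceptable.Subgraph) : Prop :=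
  M.IsMatching ∧ ∀ i j, ¬ J.Blocks M i j

/-- The pairs that belong to at least one stable matching. -/
def stablePairs (J : SRIInstance A) : Set (Sym2 A) :=
  {e | ∃ M : J.acceptable.Subgraph, J.IsStableMatching M ∧ e ∈ M.edgeSet}

end SRIInstance

/-- A stable roommates instance: every agent ranks all other agents. -/
structure SRInstance (A : Type*) extends SRIInstance A where
  complete : ∀ i j, i ≠ j → acceptable.Adj i j

/-- `C` is one of the cycles of the permutation `σ`, written in cyclic order; the fixed points of
`σ` count as cycles of length one. -/
def IsCycleOfPerm {A : Type*} (σ : Equiv.Perm A) (C : Cycle A) : Prop :=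
  C ≠ Cycle.nil ∧ C.Nodup ∧ C.Chain (fun a b => σ a = b)

def oddCycles {A : Type*} (σ : Equiv.Perm A) : Set (Cycle A) :=
  {C | IsCycleOfPerm σ C ∧ Odd C.length}

def oddAgents {A : Type*} (σ : Equiv.Perm A) : Set A :=
  {a | ∃ C ∈ oddCycles σ, a ∈ C}

namespace SRInstance

variable {A : Type*}

/-- `i` strictly prefers `j` to `k`, where `k` may be `i` itself: every agent prefers each other
agent to being on its own. -/
def PrefersExt (I : SRInstance A) (i j k : A) : Prop :=
  I.prefers i j k ∨ (k = i ∧ j ≠ i)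

/-- Every agent weakly prefers its successor to its predecessor, and no two agents strictly prefer
each other to their predecessors. -/
def IsStablePartition (I : SRInstance A) (σ : Equiv.Perm A) : Prop :=
  (∀ i, σ i = σ⁻¹ i ∨ I.prefers i (σ i) (σ⁻¹ i)) ∧
    ¬ ∃ i j, i ≠ j ∧ I.PrefersExt i j (σ⁻¹ i) ∧ I.PrefersExt j i (σ⁻¹ j)

/-- The reduced stable cycles: the cycles of length two or of odd length that occur in some stable
partition. -/
def reducedStableCycles (I : SRInstance A) : Set (Cycle A) :=
  {C | (∃ σ, I.IsStablePartition σ ∧ IsCycleOfPerm σ C) ∧ (C.length = 2 ∨ Odd C.length)}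

/-- `k` is truncated from the list of `j`: some agent `i` in an odd cycle of `σ` prefers `j` to its
own predecessor, and `j` ranks `k` worse than `i`. -/
def Truncated (I : SRInstance A) (σ : Equiv.Perm A) (j k : A) : Prop :=
  ∃ i ∈ oddAgents σ, I.PrefersExt i j (σ⁻¹ i) ∧ I.prefers j i k

/-- The instance derived from `I` and a stable partition `σ` of it. Whenever an agent `i` in an odd
cycle prefers `j` to its predecessor, the list of `j` is truncated after `i` (the deleted pairs
become mutually unacceptable), and then all agents in odd cycles are deleted. -/
def derived (I : SRInstance A) (σ : Equiv.Perm A) : SRIInstance {a : A // a ∉ oddAgents σ} where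
  acceptable :=
    { Adj := fun j k => j ≠ k ∧ ¬ I.Truncated σ j k ∧ ¬ I.Truncated σ k j
      symm := ⟨fun _ _ h => ⟨h.1.symm, h.2.2, h.2.1⟩⟩
      loopless := ⟨fun _ h => h.1 rfl⟩ }
  prefers := fun j k l =>
    (j ≠ k ∧ ¬ I.Truncated σ j k ∧ ¬ I.Truncated σ k j) ∧
      (j ≠ l ∧ ¬ I.Truncated σ j l ∧ ¬ I.Truncated σ l j) ∧ I.prefers j k l
  prefers_left := fun _ _ _ h => h.1
  prefers_right := fun _ _ _ h => h.2.1
  prefers_irrefl := fun _ _ h => I.prefers_irrefl _ _ h.2.2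
  prefers_trans := fun _ _ _ _ h h' => ⟨h.1, h'.2.1, I.prefers_trans _ _ _ _ h.2.2 h'.2.2⟩
  prefers_total := fun _ _ _ h h' hne =>
    (I.prefers_total _ _ _ (I.complete _ _ fun e => h.1 (Subtype.ext e))
      (I.complete _ _ fun e => h'.1 (Subtype.ext e)) fun e => hne (Subtype.ext e)).imp
      (fun p => ⟨h, h', p⟩) fun p => ⟨h', h, p⟩

end SRInstance

/-! Three facts carry the theorem: stable partitions exist, all of them have the same odd cycles,
and the part outside the odd cycles is governed by the perfect stable matchings of the derived
instance.

Existence (`exists_rankStable`): duplicate the agents into proposers and receivers. Among the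
bipartite stable matchings `σ` in which everyone likes `σ i` at least as much as `σ⁻¹ i`, take one
with the least total rank of `σ i`. Moving the proposers on along all rotations at once gives a
stable matching between `σ⁻¹` and `σ`; minimality then forces every proposer's next choice to be
`σ⁻¹ i` (or `σ i` when the two agree), which excludes blocking pairs of the partition.

Invariance (`RankStable.apply_eq_of_odd`): for stable `p` and `q`, the nonnegative slacks of `p` on
the arcs of `q` and of `q` on the arcs of `p` have total zero (`sum_arcSlack`). Hence, where `p` and
`q` differ, one is at least as good as the other at each agent, with the roles alternating along the
cycle; an odd cycle cannot alternate.

Even cycles split into transpositions, so stable partitions correspond, up to such splitting, to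
stable matchings of the derived instance. The reduced stable cycles are therefore the odd cycles
together with the stable pairs, and the upper bound follows by counting agents. -/

/-- Bipartite stability: `σ` matches the proposer copy of `i` to the receiver copy of `σ i`, and no
proposer `i` and receiver `j` rank each other (by `r i` and `r j`) above their partners. -/
def BiStable {A : Type*} (r : A → A → ℕ) (σ : Equiv.Perm A) : Prop :=
  ∀ i j, r i j ≤ r i (σ i) ∨ r j i ≤ r j (σ⁻¹ j)

/-- Stability of a partition, with the preferences given by rank functions (larger is better). -/
def RankStable {A : Type*} (r : A → A → ℕ) (σ : Equiv.Perm A) : Prop :=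
  (∀ i, r i (σ⁻¹ i) ≤ r i (σ i)) ∧ ∀ i j, r i j ≤ r i (σ⁻¹ i) ∨ r j i ≤ r j (σ⁻¹ j)

theorem BiStable.inv {A : Type*} {r : A → A → ℕ} {σ : Equiv.Perm A} (hσ : BiStable r σ) :
    BiStable r σ⁻¹ :=
  fun i j => by simpa using (hσ j i).symm

/-- The two sides of a bipartite instance have opposite interests. -/
theorem BiStable.inv_le_inv {A : Type*} {r : A → A → ℕ}
    (hr : ∀ i, Function.Injective (r i)) {σ τ : Equiv.Perm A} (hτ : BiStable r τ)
    (h : ∀ i, r i (τ i) ≤ r i (σ i)) (i : A) :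
    r i (σ⁻¹ i) ≤ r i (τ⁻¹ i) := by
  rcases hτ (σ⁻¹ i) i with h1 | h1
  · have h2 := h (σ⁻¹ i)
    have h3 : σ (σ⁻¹ i) = i := by simp
    rw [h3] at h2
    have h4 : i = τ (σ⁻¹ i) := hr _ (le_antisymm h1 h2)
    rw [← Equiv.Perm.inv_eq_iff_eq] at h4
    rw [h4]
  · exact h1

/-! ### Existence of stable partitions. -/

section Existence

variable {A : Type*} [Finite A] {r : A → A → ℕ}

/-- The Gale–Shapley theorem for the bipartite instance in which both sides are copies of `A`. -/
theorem exists_biStable (hr : ∀ i, Function.Injective (r i)) : ∃ σ, BiStable r σ := by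
  classical
  -- `(m, w) ∈ R` will mean that `w` rejects `m`: she ranks above `m` some proposer already rejected
  -- by everyone he prefers to her. Only the fixed-point equation is used, not leastness.
  let F : Set (A × A) →o Set (A × A) :=
    { toFun := fun R => {x | ∃ k, r x.2 x.1 < r x.2 k ∧ ∀ w, r k x.2 < r k w → (k, w) ∈ R}
      monotone' := by
        rintro R S hRS x ⟨k, hk, h⟩
        exact ⟨k, hk, fun w hw => hRS (h w hw)⟩ }
  obtain ⟨R, hR⟩ : ∃ R, F R = R := ⟨_, F.map_lfp⟩
  have hmem : ∀ i w, (i, w) ∈ R ↔ ∃ k, r w i < r w k ∧ ∀ v, r k w < r k v → (k, v) ∈ R := by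
    intro i w
    conv_lhs => rw [← hR]
    rfl
  -- the best proposer of a woman who has a proposal is not rejected
  have hbest : ∀ w k, (∀ v, r k w < r k v → (k, v) ∈ R) →
      ∃ m, r w k ≤ r w m ∧ (m, w) ∉ R ∧ ∀ v, r m w < r m v → (m, v) ∈ R := by
    intro w k hk
    obtain ⟨m, hm, hmax⟩ := Set.exists_max_image {m | ∀ v, r m w < r m v → (m, v) ∈ R} (r w)
      (Set.toFinite _) ⟨k, hk⟩
    refine ⟨m, hmax k hk, ?_, hm⟩
    rw [hmem]
    rintro ⟨k', h1, h2⟩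
    exact absurd (hmax k' h2) (not_le.2 h1)
  have hinj : ∀ m w v, (m, w) ∉ R → (m, v) ∉ R → (∀ u, r m w < r m u → (m, u) ∈ R) →
      (∀ u, r m v < r m u → (m, u) ∈ R) → w = v := by
    intro m w v h1 h2 h3 h4
    by_contra hne
    rcases lt_or_gt_of_ne (fun e => hne (hr m e)) with h | h
    · exact h2 (h3 v h)
    · exact h1 (h4 w h)
  -- Someone rejected everywhere proposes everywhere, so every receiver holds a best proposer; these
  -- are distinct, hence exhaust `A`, and he is one of them.
  have hex : ∀ i, ∃ w, (i, w) ∉ R := by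
    by_contra! hcon
    obtain ⟨i, hi⟩ := hcon
    have : ∀ w, ∃ m, (m, w) ∉ R ∧ ∀ v, r m w < r m v → (m, v) ∈ R := fun w => by
      obtain ⟨m, -, hm⟩ := hbest w i (fun v _ => hi v)
      exact ⟨m, hm⟩
    choose g hg using this
    have hgi : Function.Injective g := by
      intro w v h
      exact hinj (g w) w v (hg w).1 (h ▸ (hg v).1) (hg w).2 (h ▸ (hg v).2)
    obtain ⟨w, rfl⟩ := (Finite.injective_iff_surjective.1 hgi) i
    exact (hg w).1 (hi w)
  have hex' : ∀ i, ∃ w, (i, w) ∉ R ∧ ∀ v, r i w < r i v → (i, v) ∈ R := by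
    intro i
    obtain ⟨w, hw, hmax⟩ := Set.exists_max_image {w | (i, w) ∉ R} (r i) (Set.toFinite _) (hex i)
    refine ⟨w, hw, fun v hv => ?_⟩
    by_contra h
    exact absurd (hmax v h) (not_le.2 hv)
  choose s hs1 hs2 using hex'
  have hsi : Function.Injective s := by
    intro i k h
    by_contra hne
    rcases lt_or_gt_of_ne (fun e => hne (hr (s i) e)) with h' | h'
    · exact hs1 i ((hmem _ _).2 ⟨k, h', h ▸ hs2 k⟩)
    · exact hs1 k ((hmem _ _).2 ⟨i, h ▸ h', h ▸ hs2 i⟩)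
  refine ⟨Equiv.ofBijective s (Finite.injective_iff_bijective.1 hsi), fun i j => ?_⟩
  by_contra! hcon
  obtain ⟨h1, h2⟩ := hcon
  obtain ⟨k, hk1, hk2⟩ := (hmem i j).1 (hs2 i j h1)
  obtain ⟨m, hm1, hm2, hm3⟩ := hbest j k hk2
  have hm : s m = j := hinj m _ _ (hs1 m) hm2 (hs2 m) hm3
  have : (Equiv.ofBijective s (Finite.injective_iff_bijective.1 hsi))⁻¹ j = m := by
    rw [Equiv.Perm.inv_eq_iff_eq]
    exact hm.symm
  rw [this] at h2
  omega

/-- The join of a bipartite stable matching and its inverse. -/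
theorem BiStable.exists_sup_inv (hr : ∀ i, Function.Injective (r i)) {σ : Equiv.Perm A}
    (hσ : BiStable r σ) :
    ∃ τ, BiStable r τ ∧ (∀ i, r i (τ⁻¹ i) ≤ r i (τ i)) ∧
      ∀ i, r i (τ i) = max (r i (σ i)) (r i (σ⁻¹ i)) := by
  classical
  let t : A → A := fun i => if r i (σ⁻¹ i) ≤ r i (σ i) then σ i else σ⁻¹ i
  have ht : ∀ i, r i (t i) = max (r i (σ i)) (r i (σ⁻¹ i)) := by
    intro i
    simp only [t]
    split_ifs <;> omega
  have ht' : ∀ i, t i = σ i ∨ t i = σ⁻¹ i := by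
    intro i
    simp only [t]
    split_ifs <;> simp
  -- If `i ≠ k` both choose `w = σ i = σ⁻¹ k`, stability at `(k, w)` makes `w` rank `i` at least as
  -- high as `k`, and stability at `(w, i)` gives the converse.
  have key : ∀ i k, t i = σ i → t k = σ⁻¹ k → t i = t k → i = k := by
    intro i k hi hk h
    have e1 : σ i = σ⁻¹ k := by rw [← hi, h, hk]
    have e2 : k = σ (σ i) := by rw [e1]; simp
    by_contra hne
    have h1 := ht i
    have h2 := ht k
    rw [hi] at h1
    rw [hk, ← e1] at h2
    have h3 : r i (σ i) ≠ r i (σ⁻¹ i) := fun e => hne (by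
      have := hr i e
      rw [e2, this]; simp)
    have h4 : r k (σ i) ≠ r k (σ k) := fun e => hne (by
      have := hr k e
      simpa using this)
    have h5 := hσ k (σ i)
    have h6 := hσ (σ i) i
    have e3 : σ⁻¹ (σ i) = i := by simp
    rw [e3] at h5
    rw [← e2] at h6
    have h7 : r (σ i) i ≠ r (σ i) k := fun e => hne (hr _ e)
    omega
  have hinj : Function.Injective t := by
    intro i k h
    rcases ht' i with hi | hi <;> rcases ht' k with hk | hk
    · exact σ.injective (by rw [← hi, ← hk, h])
    · exact key i k hi hk h
    · exact (key k i hk hi h.symm).symm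
    · exact σ⁻¹.injective (by rw [← hi, ← hk, h])
  let τ : Equiv.Perm A := Equiv.ofBijective t (Finite.injective_iff_bijective.1 hinj)
  have hτ : ∀ i, τ i = t i := fun i => rfl
  have hτi : ∀ i, τ⁻¹ i = σ⁻¹ i ∨ τ⁻¹ i = σ i := by
    intro i
    have h0 : t (τ⁻¹ i) = i := by rw [← hτ]; simp
    rcases ht' (τ⁻¹ i) with h | h
    · left
      rw [Equiv.Perm.eq_inv_iff_eq, ← h, h0]
    · right
      rw [← Equiv.Perm.inv_eq_iff_eq, ← h, h0]
  refine ⟨τ, ?_, ?_, ht⟩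
  · intro i j
    rw [hτ, ht]
    have h1 := hσ i j
    have h2 := hσ j i
    rcases hτi j with h | h <;> rw [h] <;> omega
  · intro i
    rw [hτ, ht]
    rcases hτi i with h | h <;> rw [h] <;> simp

/-- A bipartite stable matching that dominates its inverse and is minimal with this property
determines, up to inversion at each agent, all stable matchings between its inverse and itself. -/
theorem BiStable.eq_or_eq_inv_of_minimal (hr : ∀ i, Function.Injective (r i)) [Fintype A]
    {σ τ : Equiv.Perm A} (hσ : BiStable r σ)
    (hmin : ∀ ρ, BiStable r ρ → (∀ i, r i (ρ⁻¹ i) ≤ r i (ρ i)) →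
      ∑ i, r i (σ i) ≤ ∑ i, r i (ρ i))
    (hτ : BiStable r τ) (h1 : ∀ i, r i (σ⁻¹ i) ≤ r i (τ i)) (h2 : ∀ i, r i (τ i) ≤ r i (σ i))
    (i : A) : (τ i = σ i ∧ τ⁻¹ i = σ⁻¹ i) ∨ (τ i = σ⁻¹ i ∧ τ⁻¹ i = σ i) := by
  obtain ⟨ρ, hρ, hρ', hmax⟩ := hτ.exists_sup_inv hr
  have h3 := hτ.inv_le_inv hr h2
  have h4 : ∀ i, r i (τ⁻¹ i) ≤ r i (σ i) := by
    simpa using hσ.inv.inv_le_inv hr h1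
  -- The join `ρ` of `τ` and `τ⁻¹` lies below `σ`, so minimality of the sum makes them equal agent
  -- by agent.
  have hle : ∀ i ∈ Finset.univ, r i (ρ i) ≤ r i (σ i) := fun i _ => by
    rw [hmax]; exact max_le (h2 i) (h4 i)
  have heq := (Finset.sum_eq_sum_iff_of_le hle).1
    (le_antisymm (Finset.sum_le_sum hle) (hmin ρ hρ hρ'))
  have hor : ∀ i, σ i = τ i ∨ σ i = τ⁻¹ i := by
    intro i
    have e := heq i (Finset.mem_univ i)
    rw [hmax] at e
    rcases max_choice (r i (τ i)) (r i (τ⁻¹ i)) with h | h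
    · exact Or.inl (hr i (by omega))
    · exact Or.inr (hr i (by omega))
  have hor' : σ⁻¹ i = τ⁻¹ i ∨ σ⁻¹ i = τ i := by
    rcases hor (σ⁻¹ i) with h | h
    · left
      rw [Equiv.Perm.eq_inv_iff_eq, ← h]; simp
    · right
      rw [← Equiv.Perm.inv_eq_iff_eq, ← h]; simp
  by_cases hM : σ i = σ⁻¹ i
  · have e1 : τ i = σ i := hr i (le_antisymm (h2 i) (by rw [hM]; exact h1 i))
    have e2 : τ⁻¹ i = σ⁻¹ i := hr i (le_antisymm (by rw [← hM]; exact h4 i) (h3 i))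
    exact Or.inl ⟨e1, e2⟩
  · rcases hor i with h | h <;> rcases hor' with h' | h'
    · exact Or.inl ⟨h.symm, h'.symm⟩
    · exact absurd (h.trans h'.symm) hM
    · exact absurd (h.trans h'.symm) hM
    · exact Or.inr ⟨h'.symm, h.symm⟩

/-- Every roommates instance has a stable partition. -/
theorem exists_rankStable (hr : ∀ i, Function.Injective (r i)) : ∃ σ, RankStable r σ := by
  classical
  have := Fintype.ofFinite A
  obtain ⟨σ, ⟨hσ, hge⟩, hmin⟩ := Set.exists_min_image
    {σ : Equiv.Perm A | BiStable r σ ∧ ∀ i, r i (σ⁻¹ i) ≤ r i (σ i)} (fun σ => ∑ i, r i (σ i))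
    (Set.toFinite _) (by
      obtain ⟨σ, hσ⟩ := exists_biStable hr
      obtain ⟨τ, h1, h2, -⟩ := hσ.exists_sup_inv hr
      exact ⟨τ, h1, h2⟩)
  replace hmin : ∀ ρ, BiStable r ρ → (∀ i, r i (ρ⁻¹ i) ≤ r i (ρ i)) →
      ∑ i, r i (σ i) ≤ ∑ i, r i (ρ i) := fun ρ h1 h2 => hmin ρ ⟨h1, h2⟩
  -- The next choice of `m`: the best receiver below `σ m` who would leave her partner for `m`. When
  -- `σ m ≠ σ⁻¹ m`, `σ⁻¹ m` is a candidate.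
  have hnext : ∀ m, ∃ n, (σ m = σ⁻¹ m → n = σ m) ∧ (σ m ≠ σ⁻¹ m →
      r m n < r m (σ m) ∧ r n (σ⁻¹ n) < r n m ∧ r m (σ⁻¹ m) ≤ r m n ∧
      ∀ w, r m w < r m (σ m) → r w (σ⁻¹ w) < r w m → r m w ≤ r m n) := by
    intro m
    by_cases hm : σ m = σ⁻¹ m
    · exact ⟨σ m, fun _ => rfl, fun h => absurd hm h⟩
    have hc1 : r m (σ⁻¹ m) < r m (σ m) :=
      lt_of_le_of_ne (hge m) fun e => hm (hr m e).symm
    have hc2 : r (σ⁻¹ m) (σ⁻¹ (σ⁻¹ m)) < r (σ⁻¹ m) m := by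
      have e : σ (σ⁻¹ m) = m := by simp
      have := hge (σ⁻¹ m)
      rw [e] at this
      refine lt_of_le_of_ne this fun e' => hm ?_
      have := hr _ e'
      rw [Equiv.Perm.inv_eq_iff_eq] at this
      exact this.symm
    obtain ⟨n, hn, hmax⟩ := Set.exists_max_image
      {w | r m w < r m (σ m) ∧ r w (σ⁻¹ w) < r w m} (r m) (Set.toFinite _) ⟨σ⁻¹ m, hc1, hc2⟩
    exact ⟨n, fun h => absurd h hm, fun _ => ⟨hn.1, hn.2, hmax _ ⟨hc1, hc2⟩,
      fun w h1 h2 => hmax w ⟨h1, h2⟩⟩⟩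
  choose nx hnx0 hnx using hnext
  have hnxM : ∀ m, σ m ≠ σ⁻¹ m → σ (nx m) ≠ σ⁻¹ (nx m) := by
    intro m hm hw
    obtain ⟨-, h2, h3, -⟩ := hnx m hm
    rcases hσ (nx m) m with h | h
    · rw [hw] at h; omega
    · have e : nx m = σ⁻¹ m := hr m (le_antisymm h h3)
      have e' : σ (nx m) = m := by rw [e]; simp
      rw [← hw, e'] at h2
      exact lt_irrefl _ h2
  -- `f` sends `m` to the current partner of his next choice. Its nontrivial periodic orbits are the
  -- rotations; `τ` below eliminates all of them together.
  let f : A → A := fun m => σ⁻¹ (nx m)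
  have hf : ∀ m, σ (f m) = nx m := fun m => by simp [f]
  let P : Set A := Function.periodicPts f
  have hbij : Set.BijOn f P P := Function.bijOn_periodicPts f
  let g : A → A := fun m => if m ∈ P then f m else m
  have hg : Function.Injective g := by
    intro m k h
    by_cases hm : m ∈ P <;> by_cases hk : k ∈ P <;> simp only [g, hm, hk, if_true, if_false] at h
    · exact hbij.injOn hm hk h
    · exact absurd (h ▸ hbij.mapsTo hm) hk
    · exact absurd (h ▸ hbij.mapsTo hk) hm
    · exact h
  let τ : Equiv.Perm A := Equiv.ofBijective (fun m => σ (g m))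
    (Finite.injective_iff_bijective.1 (σ.injective.comp hg))
  have hτP : ∀ m ∈ P, τ m = nx m := fun m hm => by
    change σ (g m) = _
    simp only [g, hm, if_true, hf]
  have hτN : ∀ m, m ∉ P → τ m = σ m := fun m hm => by
    change σ (g m) = _
    simp only [g, hm, if_false]
  have hτi : ∀ w, r w (σ⁻¹ w) ≤ r w (τ⁻¹ w) := by
    intro w
    obtain ⟨m, rfl⟩ := τ.surjective w
    have e : τ⁻¹ (τ m) = m := by simp
    rw [e]
    by_cases hm : m ∈ P
    · rw [hτP m hm]
      by_cases hM : σ m = σ⁻¹ m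
      · rw [hnx0 m hM]; simp
      · exact (hnx m hM).2.1.le
    · rw [hτN m hm]; simp
  have h1 : ∀ i, r i (σ⁻¹ i) ≤ r i (τ i) := by
    intro m
    by_cases hm : m ∈ P
    · rw [hτP m hm]
      by_cases hM : σ m = σ⁻¹ m
      · rw [hnx0 m hM]; exact hge m
      · exact (hnx m hM).2.2.1
    · rw [hτN m hm]; exact hge m
  have h2 : ∀ i, r i (τ i) ≤ r i (σ i) := by
    intro m
    by_cases hm : m ∈ P
    · rw [hτP m hm]
      by_cases hM : σ m = σ⁻¹ m
      · rw [hnx0 m hM]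
      · exact (hnx m hM).1.le
    · rw [hτN m hm]
  have hτ : BiStable r τ := by
    intro m w
    by_contra! hcon
    obtain ⟨c1, c2⟩ := hcon
    have c3 := lt_of_le_of_lt (hτi w) c2
    have c4 : r m w ≤ r m (σ m) := (hσ m w).resolve_right (not_le.2 c3)
    by_cases hm : m ∈ P
    · rw [hτP m hm] at c1
      by_cases hM : σ m = σ⁻¹ m
      · rw [hnx0 m hM] at c1; omega
      · rcases c4.lt_or_eq with c5 | c5
        · have := (hnx m hM).2.2.2 w c5 c3
          omega
        · have e := hr m c5
          rw [e] at c3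
          simp at c3
    · rw [hτN m hm] at c1; omega
  have hdich := hσ.eq_or_eq_inv_of_minimal hr hmin hτ h1 h2
  -- A non-periodic `m` with `f m` periodic shares his next choice with a periodic `m'`; both
  -- alternatives of `hdich` at that receiver are impossible. As every orbit ends in `P`, this makes
  -- all agents periodic and `τ` equal to `nx`.
  have hback : ∀ m, f m ∈ P → m ∈ P := by
    intro m hfm
    by_contra hm
    have hM : σ m ≠ σ⁻¹ m := by
      intro hM
      have : f m = m := by simp [f, hnx0 m hM]
      exact hm (this ▸ hfm)
    have hmi : τ⁻¹ m = σ⁻¹ m := by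
      rcases hdich m with h | h
      · exact h.2
      · exact absurd ((hτN m hm).symm.trans h.1) hM
    obtain ⟨m', hm', hff⟩ := hbij.surjOn hfm
    have hw : nx m' = nx m := by rw [← hf, hff, hf]
    have hτm' : τ m' = nx m := by rw [hτP m' hm', hw]
    have hinv : τ⁻¹ (nx m) = m' := by rw [← hτm']; simp
    rcases hdich (nx m) with h | h
    · have e : σ m' = nx m := by
        rw [eq_comm, ← Equiv.Perm.inv_eq_iff_eq, ← h.2, hinv]
      by_cases hM' : σ m' = σ⁻¹ m'
      · apply hnxM m hM
        rw [← e]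
        nth_rewrite 1 [hM']
        simp
      · have := (hnx m' hM').1
        rw [hw, e] at this
        exact lt_irrefl _ this
    · rcases hτ (nx m) m with h' | h'
      · rw [h.1] at h'
        exact absurd h' (not_le.2 (hnx m hM).2.1)
      · rw [hmi] at h'
        have e : nx m = σ⁻¹ m := hr m (le_antisymm h' (hnx m hM).2.2.1)
        have e' : σ (nx m) = m := by rw [e]; simp
        rw [hinv, e'] at h
        exact hm (h.2 ▸ hm')
  have hall : ∀ m, m ∈ P := by
    intro m
    obtain ⟨i, j, hij, he⟩ : ∃ i j : ℕ, i < j ∧ f^[i] m = f^[j] m := by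
      obtain ⟨i, j, hne, he⟩ := Finite.exists_ne_map_eq_of_infinite fun k : ℕ => f^[k] m
      rcases lt_or_gt_of_ne hne with h | h
      · exact ⟨i, j, h, he⟩
      · exact ⟨j, i, h, he.symm⟩
    have hi : f^[i] m ∈ P := by
      refine ⟨j - i, by omega, ?_⟩
      rw [Function.IsPeriodicPt, Function.IsFixedPt, ← Function.iterate_add_apply,
        Nat.sub_add_cancel hij.le, he]
    clear he hij
    induction i with
    | zero => exact hi
    | succ i ih =>
      rw [Function.iterate_succ_apply'] at hi
      exact ih (hback _ hi)
  refine ⟨σ, hge, fun i j => ?_⟩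
  by_contra! hcon
  obtain ⟨c1, c2⟩ := hcon
  have c3 : r i j ≤ r i (σ i) := (hσ i j).resolve_right (not_le.2 c2)
  have c4 : r i j ≠ r i (σ i) := by
    intro e
    rw [hr i e] at c2
    simp at c2
  have hM : σ i ≠ σ⁻¹ i := by
    intro e
    rw [← e] at c1
    omega
  obtain ⟨d1, -, -, d4⟩ := hnx i hM
  have c5 := d4 j (lt_of_le_of_ne c3 c4) c2
  rw [← hτP i (hall i)] at c5 d1
  rcases hdich i with h | h
  · rw [h.1] at d1
    exact lt_irrefl _ d1
  · rw [h.1] at c5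
    omega

end Existence

theorem Equiv.Perm.inv_apply_apply {A : Type*} (p : Equiv.Perm A) (i : A) : p⁻¹ (p i) = i := by
  simp

theorem Equiv.Perm.apply_inv_apply {A : Type*} (p : Equiv.Perm A) (i : A) : p (p⁻¹ i) = i := by
  simp

/-! ### Comparison of two stable partitions and invariance of odd cycles. -/

section Invariance

variable {A : Type*} {r : A → A → ℕ}

/-- The number of the two neighbours of `i` in `p` that `i` ranks at least as high as `j`. -/
def neighborsAbove (r : A → A → ℕ) (p : Equiv.Perm A) (i j : A) : ℤ :=
  (if r i j ≤ r i (p i) then 1 else 0) + (if r i j ≤ r i (p⁻¹ i) then 1 else 0)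

open Classical in
/-- The slack of the stability inequality of `p` at the arc `i → q i` of `q`. -/
noncomputable def arcSlack (r : A → A → ℕ) (p q : Equiv.Perm A) (i : A) : ℤ :=
  neighborsAbove r p i (q i) + neighborsAbove r p (q i) i - 2
    - (if p i = q i then 1 else 0) - (if p (q i) = i then 1 else 0)

/-- Stability gives an end of the arc whose `p`-predecessor, and hence also `p`-successor, is at
least as good as the other end, so the count reaches 2. If the two ends are already joined by an arc
of `p`, that arc supplies the units subtracted for it. -/
theorem RankStable.arcSlack_nonneg {p : Equiv.Perm A} (hp : RankStable r p) (q : Equiv.Perm A)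
    (i : A) : 0 ≤ arcSlack r p q i := by
  have h1 := hp.2 i (q i)
  have h2 := hp.1 i
  have h3 := hp.1 (q i)
  have h4 : p i = q i → p⁻¹ (q i) = i := fun h => by rw [← h]; simp
  have h5 : p (q i) = i → p⁻¹ i = q i := fun h => by rw [Equiv.Perm.inv_eq_iff_eq, h]
  unfold arcSlack neighborsAbove
  by_cases e1 : p i = q i <;> by_cases e2 : p (q i) = i
  · simp [e1, e2, h4 e1, h5 e2]
  · rw [h4 e1, e1] at *
    simp only [e2, if_true, if_false, le_refl]
    split_ifs <;> omega
  · rw [h5 e2, e2] at *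
    simp only [e1, if_true, if_false, le_refl]
    split_ifs <;> omega
  · simp only [e1, e2, if_false]
    split_ifs <;> omega

theorem RankStable.arcSlack_pos {p : Equiv.Perm A} (hp : RankStable r p) {q : Equiv.Perm A}
    {i : A} (h1 : r i (q i) < r i (p i))
    (h2 : r (q i) i < r (q i) (p (q i))) : 0 < arcSlack r p q i := by
  have h3 := hp.2 i (q i)
  have e1 : p i ≠ q i := fun e => by rw [e] at h1; exact lt_irrefl _ h1
  have e2 : p (q i) ≠ i := fun e => by rw [e] at h2; exact lt_irrefl _ h2
  unfold arcSlack neighborsAbove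
  simp only [e1, e2, if_false, h1.le, h2.le, if_true]
  split_ifs <;> omega

/-- Regroup by agents. Comparing a `p`-neighbour with a `q`-neighbour in both directions counts 1,
plus 1 if they coincide; the four comparisons at an agent cancel the two constants `-2`. The
coincidences cancel after summation, because `p` and `q` have as many common successors as common
predecessors. -/
theorem sum_arcSlack (hr : ∀ i, Function.Injective (r i)) [Fintype A] (p q : Equiv.Perm A) :
    ∑ i, arcSlack r p q i + ∑ i, arcSlack r q p i = 0 := by
  classical
  have reindex : ∀ p q : Equiv.Perm A, ∑ i, arcSlack r p q i =
      ∑ i, (neighborsAbove r p i (q i) + neighborsAbove r p i (q⁻¹ i) - 2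
        - (if p i = q i then 1 else 0) - (if p i = q⁻¹ i then 1 else 0)) := by
    intro p q
    have e1 := Equiv.sum_comp q fun i => neighborsAbove r p i (q⁻¹ i)
    have e2 := Equiv.sum_comp q fun i => (if p i = q⁻¹ i then 1 else 0 : ℤ)
    simp only [Equiv.Perm.inv_apply_apply] at e1 e2
    unfold arcSlack
    simp only [Finset.sum_sub_distrib, Finset.sum_add_distrib]
    rw [e1, ← e2]
  have e3 : ∑ i, (if p i = q i then 1 else 0 : ℤ) = ∑ i, (if p⁻¹ i = q⁻¹ i then 1 else 0 : ℤ) := by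
    rw [← Equiv.sum_comp p fun i => (if p⁻¹ i = q⁻¹ i then 1 else 0 : ℤ)]
    refine Finset.sum_congr rfl fun i _ => ?_
    simp only [Equiv.Perm.inv_apply_apply, Equiv.Perm.eq_inv_iff_eq]
    simp only [eq_comm]
  rw [reindex p q, reindex q p, ← Finset.sum_add_distrib]
  have e4 : ∑ i, ((if p⁻¹ i = q⁻¹ i then 1 else 0 : ℤ) - (if p i = q i then 1 else 0)) = 0 := by
    rw [Finset.sum_sub_distrib, e3, sub_self]
  refine Eq.trans ?_ e4
  refine Finset.sum_congr rfl fun i _ => ?_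
  have key : ∀ x y : A, (if r i x ≤ r i y then 1 else 0 : ℤ) + (if r i y ≤ r i x then 1 else 0) =
      1 + (if y = x then 1 else 0) := by
    intro x y
    have : y = x ↔ r i y = r i x := (hr i).eq_iff.symm
    simp only [this]
    split_ifs <;> omega
  have k1 := key (q i) (p i)
  have k2 := key (q i) (p⁻¹ i)
  have k3 := key (q⁻¹ i) (p i)
  have k4 := key (q⁻¹ i) (p⁻¹ i)
  simp only [neighborsAbove]
  rw [eq_comm (a := q i) (b := p i), eq_comm (a := q i) (b := p⁻¹ i)]
  linarith

/-- Every arc of a stable partition `q` is, at one of its ends, at least as good as both arcs of any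
other stable partition `p`. -/
theorem RankStable.arc_best (hr : ∀ i, Function.Injective (r i)) [Finite A] {p q : Equiv.Perm A}
    (hp : RankStable r p) (hq : RankStable r q) (i : A) :
    r i (p i) ≤ r i (q i) ∨ r (q i) (p (q i)) ≤ r (q i) i := by
  have := Fintype.ofFinite A
  by_contra! hcon
  have h1 : 0 < ∑ i, arcSlack r p q i := Finset.sum_pos' (fun i _ => hp.arcSlack_nonneg q i)
    ⟨i, Finset.mem_univ i, hp.arcSlack_pos hcon.1 hcon.2⟩
  have h2 : 0 ≤ ∑ i, arcSlack r q p i := Finset.sum_nonneg fun i _ => hq.arcSlack_nonneg p i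
  have := sum_arcSlack hr p q
  omega

/-- No arc of `q` lies strictly between the two arcs of `p` at an agent. -/
theorem RankStable.not_between (hr : ∀ i, Function.Injective (r i)) [Finite A]
    {p q : Equiv.Perm A} (hp : RankStable r p) (hq : RankStable r q) (i : A) :
    (r i (q i) ≤ r i (p⁻¹ i) ∨ r i (p i) ≤ r i (q i)) ∧
      (r i (q⁻¹ i) ≤ r i (p⁻¹ i) ∨ r i (p i) ≤ r i (q⁻¹ i)) := by
  constructor
  · by_contra! hcon
    have h1 := (hp.2 i (q i)).resolve_left (not_le.2 hcon.1)
    have h2 := (hp.arc_best hr hq i).resolve_left (not_le.2 hcon.2)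
    have h3 := hp.1 (q i)
    have e : p (q i) = i := hr (q i) (by omega)
    rw [← Equiv.Perm.eq_inv_iff_eq] at e
    rw [e] at hcon
    exact lt_irrefl _ hcon.1
  · by_contra! hcon
    have h1 := (hp.2 i (q⁻¹ i)).resolve_left (not_le.2 hcon.1)
    have h2 := hp.arc_best hr hq (q⁻¹ i)
    rw [Equiv.Perm.apply_inv_apply] at h2
    replace h2 := h2.resolve_right (not_le.2 hcon.2)
    have h3 := hp.1 (q⁻¹ i)
    have e : p (q⁻¹ i) = i := hr (q⁻¹ i) (by omega)
    rw [← Equiv.Perm.eq_inv_iff_eq] at e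
    rw [e] at hcon
    exact lt_irrefl _ hcon.1

/-- The rank intervals from predecessor to successor have no endpoint of one strictly inside the
other, so they coincide or meet at most in an endpoint. -/
theorem RankStable.trichotomy (hr : ∀ i, Function.Injective (r i)) [Finite A]
    {p q : Equiv.Perm A} (hp : RankStable r p) (hq : RankStable r q) (i : A) :
    (p i = q i ∧ p⁻¹ i = q⁻¹ i) ∨ r i (p i) ≤ r i (q⁻¹ i) ∨ r i (q i) ≤ r i (p⁻¹ i) := by
  have h1 := hp.not_between hr hq i
  have h2 := hq.not_between hr hp i
  have h3 := hp.1 i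
  have h4 := hq.1 i
  by_cases h5 : r i (p i) ≤ r i (q⁻¹ i)
  · exact Or.inr (Or.inl h5)
  by_cases h6 : r i (q i) ≤ r i (p⁻¹ i)
  · exact Or.inr (Or.inr h6)
  exact Or.inl ⟨hr i (by omega), hr i (by omega)⟩

/-- Any two stable partitions agree on the agents in odd cycles. -/
theorem RankStable.apply_eq_of_odd (hr : ∀ i, Function.Injective (r i))
    (hself : ∀ i j, r i i ≤ r i j) [Finite A]
    {p q : Equiv.Perm A} (hp : RankStable r p) (hq : RankStable r q) {a : A} {k : ℕ} (hk : Odd k)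
    (ha : q^[k] a = a) : p a = q a := by
  by_cases hfix : q a = a
  · have h := hp.arc_best hr hq a
    rw [hfix, or_self] at h
    rw [hfix]
    exact hr a (le_antisymm h (hself _ _))
  -- no agent of the cycle lies in a cycle of length at most two
  have hne : ∀ n, q (q^[n] a) ≠ q⁻¹ (q^[n] a) := by
    intro n h
    rw [Equiv.Perm.eq_inv_iff_eq] at h
    have h2 : q (q a) = a := by
      apply q.injective.iterate n
      rw [← Function.iterate_succ_apply, ← Function.iterate_succ_apply,
        Function.iterate_succ_apply', Function.iterate_succ_apply', h]
    apply hfix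
    obtain ⟨m, rfl⟩ := hk
    have h3 : q^[2 * m] a = a := by
      rw [Function.iterate_mul]
      exact Function.iterate_fixed h2 m
    rw [← Nat.succ_eq_add_one, Function.iterate_succ_apply', h3] at ha
    exact ha
  -- Along the cycle, an agent for whom `p` is no better than `q` is followed by one for whom `q` is
  -- no better than `p`; `hBA` is the reverse step.
  have hAB : ∀ i, q i ≠ q⁻¹ i → r i (p i) ≤ r i (q⁻¹ i) →
      r (q i) (q (q i)) ≤ r (q i) (p⁻¹ (q i)) := by
    intro i hi hA
    have h0 : r i (q⁻¹ i) < r i (q i) := lt_of_le_of_ne (hq.1 i) fun e => hi (hr i e).symm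
    have hpi : p i ≠ q i := fun e => by rw [e] at hA; omega
    rcases hp.trichotomy hr hq (q i) with h | h | h
    · have := h.2
      rw [Equiv.Perm.inv_apply_apply, Equiv.Perm.inv_eq_iff_eq] at this
      exact absurd this.symm hpi
    · rw [Equiv.Perm.inv_apply_apply] at h
      have h1 := hp.1 i
      have h2 := hp.1 (q i)
      have h3 := (hp.2 i (q i)).resolve_left (by omega)
      have e : p⁻¹ (q i) = i := hr (q i) (by omega)
      rw [Equiv.Perm.inv_eq_iff_eq] at e
      exact absurd e.symm hpi
    · exact h
  have hBA : ∀ i, r i (q i) ≤ r i (p⁻¹ i) → r (q i) (p (q i)) ≤ r (q i) (q⁻¹ (q i)) := by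
    intro i hB
    rw [Equiv.Perm.inv_apply_apply]
    rcases hp.arc_best hr hq i with h | h
    · have h1 := hp.1 i
      have e : q i = p⁻¹ i := hr i (by omega)
      rw [e, Equiv.Perm.apply_inv_apply]
    · exact h
  have hexcl : ∀ i, q i ≠ q⁻¹ i → r i (p i) ≤ r i (q⁻¹ i) → r i (q i) ≤ r i (p⁻¹ i) → False := by
    intro i hi h1 h2
    have h3 := hp.1 i
    have h4 := hq.1 i
    exact hi (hr i (by omega))
  have halt : ∀ n b, b = q^[n] a → ∀ m,
      (r b (p b) ≤ r b (q⁻¹ b) → r (q^[2 * m] b) (p (q^[2 * m] b)) ≤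
        r (q^[2 * m] b) (q⁻¹ (q^[2 * m] b))) := by
    intro n b hb m hA
    subst hb
    induction m with
    | zero => exact hA
    | succ m ih =>
      have h1 := hne (2 * m + n)
      rw [Function.iterate_add_apply] at h1
      have := hBA _ (hAB _ h1 ih)
      rwa [← Function.iterate_succ_apply' q, ← Function.iterate_succ_apply' q] at this
  -- After an odd number of steps the roles at `a` have been exchanged, against `hexcl`. In the
  -- second case the iteration starts at `q a`, where the first role holds.
  obtain ⟨m, rfl⟩ := hk
  rcases hp.trichotomy hr hq a with h | h | h
  · exact h.1
  · exfalso
    have h1 := halt 0 a rfl m h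
    have h2 := hAB _ (hne _) h1
    rw [← Function.iterate_succ_apply' q, Nat.succ_eq_add_one, ha] at h2
    exact hexcl a (hne 0) h h2
  · exfalso
    have h1 := halt 1 (q a) rfl m (hBA a h)
    rw [← Function.iterate_succ_apply, Nat.succ_eq_add_one, ha] at h1
    exact hexcl a (hne 0) h1 h

end Invariance

/-! ### Cycles of permutations and splitting of even cycles. -/

section Cycles

open Function

variable {A : Type*}

theorem List.IsChain.eq_map_iterate {f : A → A} : ∀ {l : List A} {a : A},
    List.IsChain (fun x y => f x = y) (a :: l) →
      a :: l = (List.range (l.length + 1)).map fun n => f^[n] a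
  | [], a, _ => by simp
  | b :: l, a, h => by
    rw [List.isChain_cons_cons] at h
    have ih := h.2.eq_map_iterate
    rw [List.range_succ_eq_map, List.map_cons, List.map_map, List.length_cons, ih]
    simp only [iterate_zero, id_eq, List.cons.injEq, true_and]
    refine List.map_congr_left fun n _ => ?_
    simp [iterate_succ_apply, h.1]

/-- The chain condition makes the entries successive iterates, its closing arc makes the length a
period, and absence of duplicates makes that period minimal. -/
theorem IsCycleOfPerm.eq_periodicOrbit {σ : Equiv.Perm A} {C : Cycle A} (hC : IsCycleOfPerm σ C)
    {a : A} (ha : a ∈ C) : C = periodicOrbit σ a := by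
  obtain ⟨-, hnd, hch⟩ := hC
  obtain ⟨l, rfl⟩ : ∃ l : List A, C = ↑(a :: l) := by
    induction C using Quotient.inductionOn' with
    | h L =>
      obtain ⟨s, t, rfl⟩ := List.append_of_mem (show a ∈ L from ha)
      refine ⟨t ++ s, Cycle.coe_eq_coe.2 ⟨s.length, ?_⟩⟩
      simp
  rw [Cycle.chain_coe_cons] at hch
  rw [Cycle.nodup_coe_iff] at hnd
  have h := hch.eq_map_iterate
  rw [List.length_append, List.length_singleton, List.range_succ, List.map_append,
    List.map_singleton, ← List.cons_append] at h
  obtain ⟨h1, h2⟩ := List.append_inj' h rfl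
  have hper : IsPeriodicPt σ (l.length + 1) a := (List.cons.inj h2).1.symm
  have hmin : minimalPeriod σ a = l.length + 1 := by
    refine le_antisymm (hper.minimalPeriod_le (Nat.succ_pos _)) ?_
    by_contra! hlt
    rw [h1] at hnd
    have hinj := (List.nodup_map_iff_inj_on List.nodup_range).1 hnd
    have h0 := hinj (minimalPeriod σ a) (List.mem_range.2 hlt) 0
      (List.mem_range.2 (Nat.succ_pos _)) (by simp)
    exact (hper.minimalPeriod_pos (Nat.succ_pos _)).ne' h0
  rw [periodicOrbit_def, hmin, h1]

theorem isCycleOfPerm_pair {σ : Equiv.Perm A} {a b : A} :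
    IsCycleOfPerm σ ↑[a, b] ↔ a ≠ b ∧ σ a = b ∧ σ b = a := by
  simp [IsCycleOfPerm, Cycle.chain_coe_cons]

theorem IsCycleOfPerm.exists_mem {σ : Equiv.Perm A} {C : Cycle A} (hC : IsCycleOfPerm σ C) :
    ∃ a, a ∈ C := by
  have hne := hC.1
  induction C using Cycle.induction_on with
  | nil => exact absurd rfl hne
  | cons a l _ => exact ⟨a, by simp⟩

variable [Finite A]

theorem Equiv.Perm.mem_periodicPts (σ : Equiv.Perm A) (a : A) : a ∈ periodicPts σ :=
  σ.injective.mem_periodicPts a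

theorem isCycleOfPerm_periodicOrbit (σ : Equiv.Perm A) (a : A) :
    IsCycleOfPerm σ (periodicOrbit σ a) := by
  refine ⟨?_, nodup_periodicOrbit, ?_⟩
  · rw [Ne, periodicOrbit_eq_nil_iff_not_periodic_pt, not_not]
    exact σ.mem_periodicPts a
  · rw [periodicOrbit_chain]
    intro n _
    rw [← Nat.succ_eq_add_one, iterate_succ_apply']

theorem mem_oddAgents_iff_minimalPeriod {σ : Equiv.Perm A} {a : A} :
    a ∈ oddAgents σ ↔ Odd (minimalPeriod σ a) := by
  constructor
  · rintro ⟨C, ⟨hC, hodd⟩, ha⟩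
    rwa [hC.eq_periodicOrbit ha, periodicOrbit_length] at hodd
  · intro h
    refine ⟨_, ⟨isCycleOfPerm_periodicOrbit σ a, ?_⟩, self_mem_periodicOrbit (σ.mem_periodicPts a)⟩
    rwa [periodicOrbit_length]

theorem mem_oddAgents_iff {σ : Equiv.Perm A} {a : A} :
    a ∈ oddAgents σ ↔ ∃ k, Odd k ∧ σ^[k] a = a := by
  rw [mem_oddAgents_iff_minimalPeriod]
  refine ⟨fun h => ⟨_, h, iterate_minimalPeriod⟩, fun ⟨k, hk, h⟩ => ?_⟩
  exact hk.of_dvd_nat (IsPeriodicPt.minimalPeriod_dvd h)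

theorem apply_mem_oddAgents_iff {σ : Equiv.Perm A} {a : A} :
    σ a ∈ oddAgents σ ↔ a ∈ oddAgents σ := by
  rw [mem_oddAgents_iff_minimalPeriod, mem_oddAgents_iff_minimalPeriod,
    minimalPeriod_apply (σ.mem_periodicPts a)]

theorem inv_apply_mem_oddAgents_iff {σ : Equiv.Perm A} {a : A} :
    σ⁻¹ a ∈ oddAgents σ ↔ a ∈ oddAgents σ := by
  rw [← apply_mem_oddAgents_iff, Equiv.Perm.apply_inv_apply]

theorem apply_ne_of_notMem_oddAgents {σ : Equiv.Perm A} {a : A} (ha : a ∉ oddAgents σ) :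
    σ a ≠ a := fun h => ha (mem_oddAgents_iff.2 ⟨1, odd_one, h⟩)

theorem mem_oddAgents_of_zpow {σ : Equiv.Perm A} {a : A} {k : ℤ} (hk : Odd k)
    (h : (σ ^ k) a = a) : a ∈ oddAgents σ := by
  refine mem_oddAgents_iff.2 ⟨k.natAbs, Int.natAbs_odd.2 hk, ?_⟩
  rw [← Equiv.Perm.coe_pow]
  rcases Int.natAbs_eq k with e | e
  · rwa [e, zpow_natCast] at h
  · rw [e, zpow_neg, zpow_natCast, Equiv.Perm.inv_eq_iff_eq] at h
    exact h.symm

/-- The even cycles of a permutation can be coloured alternately with two colours. -/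
theorem exists_alternating_coloring (σ : Equiv.Perm A) :
    ∃ c : A → Prop, ∀ a, a ∉ oddAgents σ → (c (σ a) ↔ ¬ c a) := by
  let s := Equiv.Perm.SameCycle.setoid σ
  let rep : A → A := fun a => Quotient.out (Quotient.mk s a)
  have hrep : ∀ a, ∃ k : ℤ, (σ ^ k) (rep a) = a := fun a => Quotient.mk_out (s := s) a
  have hrepσ : ∀ a, rep (σ a) = rep a := by
    intro a
    have : Quotient.mk s (σ a) = Quotient.mk s a :=
      Quotient.sound (s := s) (Equiv.Perm.sameCycle_apply_left.2 (Equiv.Perm.SameCycle.refl σ a))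
    simp only [rep, this]
  -- Colour by parity of the distance from a representative of the cycle; two distances of opposite
  -- parity would yield an odd period.
  refine ⟨fun a => ∃ k : ℤ, Even k ∧ (σ ^ k) (rep a) = a, fun a ha => ?_⟩
  beta_reduce
  rw [hrepσ]
  constructor
  · rintro ⟨l, hl, hl'⟩ ⟨k, hk, hk'⟩
    refine ha (mem_oddAgents_of_zpow (k := -1 + l - k) (by grind) ?_)
    have : (σ ^ (-k)) a = rep a := by
      rw [zpow_neg, Equiv.Perm.inv_eq_iff_eq, hk']
    rw [sub_eq_add_neg, zpow_add, Equiv.Perm.mul_apply, this, zpow_add, Equiv.Perm.mul_apply, hl']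
    simp
  · intro hn
    obtain ⟨k, hk⟩ := hrep a
    have hodd : Odd k := by
      rw [← Int.not_even_iff_odd]
      exact fun h => hn ⟨k, h, hk⟩
    refine ⟨1 + k, by grind, ?_⟩
    rw [zpow_add, Equiv.Perm.mul_apply, hk, zpow_one]

/-- All even cycles of a stable partition can be split into transpositions. -/
theorem RankStable.exists_reduced {r : A → A → ℕ} {σ : Equiv.Perm A} (hσ : RankStable r σ) :
    ∃ τ, RankStable r τ ∧
      ∀ a, a ∉ oddAgents σ → τ (τ a) = a ∧ (τ a = σ a ∨ τ a = σ⁻¹ a) := by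
  classical
  obtain ⟨c, hc⟩ := exists_alternating_coloring σ
  -- Outside the odd cycles, each coloured agent is paired with its successor. Predecessors can only
  -- improve (`hge`), so no blocking pair appears.
  let s : A → A := fun a => if a ∈ oddAgents σ ∨ c a then σ a else σ⁻¹ a
  have hs1 : ∀ a ∈ oddAgents σ, s a = σ a := fun a ha => by simp [s, ha]
  have hs2 : ∀ a, c a → s a = σ a := fun a ha => by simp [s, ha]
  have hs3 : ∀ a, a ∉ oddAgents σ → ¬ c a → s a = σ⁻¹ a := fun a ha hca => by simp [s, ha, hca]
  have hci : ∀ a, a ∉ oddAgents σ → (c (σ⁻¹ a) ↔ ¬ c a) := by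
    intro a ha
    have := hc (σ⁻¹ a) (mt inv_apply_mem_oddAgents_iff.1 ha)
    rw [Equiv.Perm.apply_inv_apply] at this
    tauto
  have hss : ∀ a, a ∉ oddAgents σ → s (s a) = a := by
    intro a ha
    by_cases hca : c a
    · rw [hs2 a hca, hs3 _ (mt apply_mem_oddAgents_iff.1 ha) (by rw [hc a ha]; simpa using hca)]
      simp
    · rw [hs3 a ha hca, hs2 _ ((hci a ha).2 hca)]
      simp
  have hor : ∀ a, s a = σ a ∨ s a = σ⁻¹ a := by
    intro a
    simp only [s]
    split_ifs <;> simp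
  have hmem : ∀ a, s a ∈ oddAgents σ ↔ a ∈ oddAgents σ := by
    intro a
    rcases hor a with h | h <;> rw [h]
    · exact apply_mem_oddAgents_iff
    · exact inv_apply_mem_oddAgents_iff
  have hinj : Injective s := by
    intro a b h
    by_cases ha : a ∈ oddAgents σ
    · have hb : b ∈ oddAgents σ := by rwa [← hmem, ← h, hmem]
      rw [hs1 a ha, hs1 b hb] at h
      exact σ.injective h
    · have hb : b ∉ oddAgents σ := by rwa [← hmem, ← h, hmem]
      rw [← hss a ha, ← hss b hb, h]
  let τ : Equiv.Perm A := Equiv.ofBijective s (Finite.injective_iff_bijective.1 hinj)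
  have hτ : ∀ a, τ a = s a := fun a => rfl
  have hτi1 : ∀ a ∈ oddAgents σ, τ⁻¹ a = σ⁻¹ a := by
    intro a ha
    rw [Equiv.Perm.inv_eq_iff_eq, hτ, hs1 _ (inv_apply_mem_oddAgents_iff.2 ha)]
    simp
  have hτi2 : ∀ a, a ∉ oddAgents σ → τ⁻¹ a = s a := by
    intro a ha
    rw [Equiv.Perm.inv_eq_iff_eq, hτ, hss a ha]
  have hge : ∀ a, r a (σ⁻¹ a) ≤ r a (τ⁻¹ a) := by
    intro a
    by_cases ha : a ∈ oddAgents σ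
    · rw [hτi1 a ha]
    · rw [hτi2 a ha]
      rcases hor a with h | h <;> rw [h]
      exact hσ.1 a
  refine ⟨τ, ⟨fun a => ?_, fun i j => ?_⟩, fun a ha => ⟨hss a ha, hor a⟩⟩
  · by_cases ha : a ∈ oddAgents σ
    · rw [hτi1 a ha, hτ, hs1 a ha]
      exact hσ.1 a
    · rw [hτi2 a ha, hτ]
  · have h1 := hσ.2 i j
    have h2 := hge i
    have h3 := hge j
    omega

end Cycles

/-! ### Translation to rank functions and consequences for stable partitions. -/

namespace SRInstance

variable {A : Type*} (I : SRInstance A)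

theorem prefers_ne_left {i j k : A} (h : I.prefers i j k) : i ≠ j := (I.prefers_left _ _ _ h).ne

theorem prefersExt_iff_prefers {i j k : A} (h : k ≠ i) : I.PrefersExt i j k ↔ I.prefers i j k := by
  simp [PrefersExt, h]

theorem PrefersExt.ne_self {I : SRInstance A} {i j k : A} (h : I.PrefersExt i j k) : j ≠ i := by
  rcases h with h | h
  · exact (I.prefers_ne_left h).symm
  · exact h.2

theorem prefersExt_irrefl (i j : A) : ¬ I.PrefersExt i j j := by
  rintro (h | h)
  · exact I.prefers_irrefl _ _ h
  · exact h.2 h.1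

theorem PrefersExt.trans {I : SRInstance A} {i j k l : A} (h : I.PrefersExt i j k)
    (h' : I.PrefersExt i k l) : I.PrefersExt i j l := by
  have hk := h'.ne_self
  rw [prefersExt_iff_prefers _ hk] at h
  rcases h' with h' | h'
  · exact Or.inl (I.prefers_trans _ _ _ _ h h')
  · exact Or.inr ⟨h'.1, (I.prefers_ne_left h).symm⟩

theorem prefersExt_total (i : A) {j k : A} (h : j ≠ k) :
    I.PrefersExt i j k ∨ I.PrefersExt i k j := by
  by_cases hj : j = i
  · exact Or.inr (Or.inr ⟨hj, fun e => h (hj.trans e.symm)⟩)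
  by_cases hk : k = i
  · exact Or.inl (Or.inr ⟨hk, hj⟩)
  exact (I.prefers_total i j k (I.complete _ _ (Ne.symm hj)) (I.complete _ _ (Ne.symm hk)) h).imp
    Or.inl Or.inl

/-- The number of agents, possibly including `i` itself, that `i` ranks below `j`. -/
noncomputable def rank (i j : A) : ℕ := {k | I.PrefersExt i j k}.ncard

variable [Finite A]

theorem rank_lt_rank_of_prefersExt {i j k : A} (h : I.PrefersExt i j k) :
    I.rank i k < I.rank i j :=
  Set.ncard_lt_ncard ⟨fun _ hl => h.trans hl, fun hs => I.prefersExt_irrefl i k (hs h)⟩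

theorem rank_lt_rank_iff {i j k : A} : I.rank i k < I.rank i j ↔ I.PrefersExt i j k := by
  refine ⟨fun h => ?_, I.rank_lt_rank_of_prefersExt⟩
  have hne : j ≠ k := by rintro rfl; exact lt_irrefl _ h
  refine (I.prefersExt_total i hne).resolve_right fun h' => ?_
  exact lt_asymm h (I.rank_lt_rank_of_prefersExt h')

theorem rank_injective (i : A) : Function.Injective (I.rank i) := by
  intro j k h
  by_contra hne
  rcases I.prefersExt_total i hne with h' | h' <;>
  · have := I.rank_lt_rank_of_prefersExt h'
    omega

theorem rank_self_le (i j : A) : I.rank i i ≤ I.rank i j := by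
  by_contra! h
  exact (I.rank_lt_rank_iff.1 h).ne_self rfl

theorem isStablePartition_iff {σ : Equiv.Perm A} :
    I.IsStablePartition σ ↔ RankStable I.rank σ := by
  refine and_congr (forall_congr' fun i => ?_) ?_
  · rw [le_iff_lt_or_eq, rank_lt_rank_iff, (I.rank_injective i).eq_iff, or_comm, eq_comm]
    refine or_congr (or_iff_left ?_).symm Iff.rfl
    rintro ⟨h1, h2⟩
    rw [Equiv.Perm.inv_eq_iff_eq] at h1
    exact h2 h1.symm
  · constructor
    · intro h i j
      by_contra! hcon
      rw [rank_lt_rank_iff, rank_lt_rank_iff] at hcon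
      exact h ⟨i, j, hcon.2.ne_self, hcon⟩
    · rintro h ⟨i, j, -, h1, h2⟩
      rw [← rank_lt_rank_iff] at h1 h2
      have := h i j
      omega

theorem exists_isStablePartition : ∃ σ, I.IsStablePartition σ := by
  simp only [isStablePartition_iff]
  exact exists_rankStable I.rank_injective

variable {I} {σ τ : Equiv.Perm A}

theorem IsStablePartition.apply_eq (hσ : I.IsStablePartition σ) (hτ : I.IsStablePartition τ)
    {a : A} (ha : a ∈ oddAgents σ) : τ a = σ a := by
  rw [isStablePartition_iff] at hσ hτ
  obtain ⟨k, hk, h⟩ := mem_oddAgents_iff.1 ha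
  exact hτ.apply_eq_of_odd I.rank_injective I.rank_self_le hσ hk h

theorem IsStablePartition.oddCycles_subset (hσ : I.IsStablePartition σ)
    (hτ : I.IsStablePartition τ) : oddCycles σ ⊆ oddCycles τ := by
  rintro C ⟨hC, hodd⟩
  refine ⟨⟨hC.1, hC.2.1, ?_⟩, hodd⟩
  obtain ⟨a, ha⟩ := hC.exists_mem
  rw [hC.eq_periodicOrbit ha, Function.periodicOrbit_chain]
  intro n _
  have hmem : ∀ n, σ^[n] a ∈ oddAgents σ := by
    intro n
    induction n with
    | zero => exact ⟨C, ⟨hC, hodd⟩, ha⟩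
    | succ n ih => rwa [Function.iterate_succ_apply', apply_mem_oddAgents_iff]
  rw [hσ.apply_eq hτ (hmem n), ← Nat.succ_eq_add_one, Function.iterate_succ_apply']

/-- All stable partitions have the same odd cycles. -/
theorem IsStablePartition.oddCycles_eq (hσ : I.IsStablePartition σ)
    (hτ : I.IsStablePartition τ) : oddCycles σ = oddCycles τ :=
  (hσ.oddCycles_subset hτ).antisymm (hτ.oddCycles_subset hσ)

theorem IsStablePartition.oddAgents_eq (hσ : I.IsStablePartition σ)
    (hτ : I.IsStablePartition τ) : oddAgents σ = oddAgents τ := by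
  unfold oddAgents
  rw [hσ.oddCycles_eq hτ]

theorem IsStablePartition.inv_apply_eq (hσ : I.IsStablePartition σ) (hτ : I.IsStablePartition τ)
    {a : A} (ha : a ∈ oddAgents σ) : τ⁻¹ a = σ⁻¹ a := by
  rw [Equiv.Perm.inv_eq_iff_eq, hσ.apply_eq hτ (inv_apply_mem_oddAgents_iff.2 ha)]
  simp

theorem IsStablePartition.exists_reduced (hσ : I.IsStablePartition σ) :
    ∃ τ, I.IsStablePartition τ ∧
      ∀ a, a ∉ oddAgents σ → τ (τ a) = a ∧ (τ a = σ a ∨ τ a = σ⁻¹ a) := by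
  obtain ⟨τ, h1, h3⟩ := (I.isStablePartition_iff.1 hσ).exists_reduced
  exact ⟨τ, I.isStablePartition_iff.2 h1, h3⟩

end SRInstance

/-! ### Stable matchings of the derived instance. -/

/-- If some stable matching covers all agents, then every stable matching does. -/
theorem SRIInstance.IsStableMatching.verts_eq_univ {B : Type*} [Finite B] {J : SRIInstance B}
    {M N : J.acceptable.Subgraph} (hM : J.IsStableMatching M) (hN : J.IsStableMatching N)
    (hNv : N.verts = Set.univ) : M.verts = Set.univ := by
  classical
  have hn : ∀ a, ∃ b, N.Adj a b := fun a => (hN.1 (hNv ▸ Set.mem_univ a)).exists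
  choose n hn using hn
  have hm : ∀ a, ∃ b, a ∈ M.verts → M.Adj a b := by
    intro a
    by_cases ha : a ∈ M.verts
    · obtain ⟨b, hb⟩ := (hM.1 ha).exists
      exact ⟨b, fun _ => hb⟩
    · exact ⟨a, fun h => absurd h ha⟩
  choose m hm using hm
  have hnu : ∀ {a b}, N.Adj a b → n a = b := fun {a b} h => hN.1.eq_of_adj_left (hn a) h
  have hmu : ∀ {a b}, M.Adj a b → m a = b := fun {a b} h =>
    hM.1.eq_of_adj_left (hm a (M.edge_vert h)) h
  -- `X` gains from `N` and `Y` from `M`. Stability of `M` sends `X` injectively into `Y` by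
  -- `N`-partners, stability of `N` sends `Y` injectively into the matched part of `X` by
  -- `M`-partners; so `X` has no unmatched member.
  let X : Set B := {a | a ∉ M.verts ∨ J.prefers a (n a) (m a)}
  let Y : Set B := {a | a ∈ M.verts ∧ J.prefers a (m a) (n a)}
  have hXY : Set.MapsTo n X Y := by
    intro a ha
    have hnb : n (n a) = a := hnu (hn a).symm
    have hadj := (hn a).adj_sub
    have hblock := hM.2 a (n a)
    simp only [SRIInstance.Blocks, not_and, not_or, not_exists, not_not] at hblock
    obtain ⟨hv, hp⟩ := hblock hadj (by
      by_cases hav : a ∈ M.verts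
      · exact Or.inr ⟨m a, hm a hav, ha.resolve_left (not_not.2 hav)⟩
      · exact Or.inl hav)
    refine ⟨hv, ?_⟩
    rw [hnb]
    have hne : m (n a) ≠ a := by
      intro h
      have h1 : M.Adj (n a) a := by simpa [h] using hm (n a) hv
      have h2 := ha.resolve_left (not_not.2 (M.edge_vert h1.symm))
      rw [hmu h1.symm] at h2
      exact J.prefers_irrefl _ _ h2
    exact (J.prefers_total (n a) _ _ (hm _ hv).adj_sub hadj.symm hne).resolve_right
      (hp _ (hm _ hv))
  have hYX : Set.MapsTo m Y (X ∩ M.verts) := by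
    rintro b ⟨hb, hpb⟩
    have hmb := hm b hb
    have hmm : m (m b) = b := hmu hmb.symm
    refine ⟨Or.inr ?_, M.edge_vert hmb.symm⟩
    rw [hmm]
    have hne : n (m b) ≠ b := by
      intro h
      have h1 : N.Adj (m b) b := by simpa [h] using hn (m b)
      rw [hnu h1.symm] at hpb
      exact J.prefers_irrefl _ _ hpb
    refine (J.prefers_total (m b) _ _ (hn _).adj_sub hmb.adj_sub.symm hne).resolve_right ?_
    intro h
    exact hN.2 b (m b) ⟨hmb.adj_sub, Or.inr ⟨_, hn b, hpb⟩, Or.inr ⟨_, hn _, h⟩⟩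
  have hninj : Set.InjOn n X := fun a _ b _ h => by
    rw [← hnu (hn a).symm, h, hnu (hn b).symm]
  have hminj : Set.InjOn m Y := fun a ha b hb h => by
    rw [← hmu (hm a ha.1).symm, h, hmu (hm b hb.1).symm]
  have h1 := Set.ncard_le_ncard_of_injOn n hXY hninj
  have h2 := Set.ncard_le_ncard_of_injOn m hYX hminj
  have h3 : X ∩ M.verts = X :=
    Set.eq_of_subset_of_ncard_le Set.inter_subset_left (h1.trans h2)
  refine Set.eq_univ_of_forall fun a => ?_
  by_contra ha
  have : a ∈ X ∩ M.verts := by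
    rw [h3]
    exact Or.inl ha
  exact ha this.2

namespace SRInstance

variable {A : Type*} [Finite A] {I : SRInstance A} {σ τ : Equiv.Perm A}

/-- A stable partition without even cycles of length at least four restricts to a stable matching
of the derived instance. -/
theorem IsStablePartition.exists_isStableMatching (hσ : I.IsStablePartition σ)
    (hτ : I.IsStablePartition τ) (hττ : ∀ a, a ∉ oddAgents σ → τ (τ a) = a) :
    ∃ M : (I.derived σ).acceptable.Subgraph, (I.derived σ).IsStableMatching M ∧
      M.verts = Set.univ ∧ ∀ a b, M.Adj a b ↔ τ a = b := by
  have hodd := hσ.oddAgents_eq hτ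
  have hinv : ∀ a, a ∉ oddAgents σ → τ⁻¹ a = τ a := fun a ha => by
    rw [Equiv.Perm.inv_eq_iff_eq, hττ a ha]
  have hne : ∀ a, a ∉ oddAgents σ → τ a ≠ a := fun a ha =>
    apply_ne_of_notMem_oddAgents (hodd ▸ ha)
  -- `τ` and `σ` have the same predecessors on odd cycles, so the agent causing the truncation would
  -- block `τ` together with `a`.
  have htr : ∀ a, a ∉ oddAgents σ → ¬ I.Truncated σ a (τ a) := by
    rintro a ha ⟨i, hi, h1, h2⟩
    refine hτ.2 ⟨i, a, ?_, ?_, ?_⟩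
    · rintro rfl
      exact ha hi
    · rwa [hσ.inv_apply_eq hτ hi]
    · rw [hinv a ha]
      exact Or.inl h2
  let M : (I.derived σ).acceptable.Subgraph :=
    { verts := Set.univ
      Adj := fun a b => τ a = b
      adj_sub := by
        rintro ⟨a, ha⟩ ⟨b, hb⟩ (rfl : τ a = b)
        refine ⟨fun h => hne a ha (congrArg Subtype.val h).symm, htr a ha, ?_⟩
        have := htr (τ a) hb
        rwa [hττ a ha] at this
      edge_vert := fun _ => Set.mem_univ _
      symm := ⟨by
        rintro ⟨a, ha⟩ ⟨b, hb⟩ (rfl : τ a = b)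
        exact hττ a ha⟩ }
  refine ⟨M, ⟨?_, ?_⟩, rfl, fun a b => Iff.rfl⟩
  · rintro ⟨a, ha⟩ -
    have hmem : τ a ∉ oddAgents σ := by
      rw [hodd, apply_mem_oddAgents_iff, ← hodd]
      exact ha
    exact ⟨⟨τ a, hmem⟩, rfl, fun b hb => Subtype.ext (Eq.symm hb)⟩
  · rintro i j ⟨hadj, h1, h2⟩
    obtain ⟨k, rfl', hk⟩ := h1.resolve_left (not_not.2 (Set.mem_univ i))
    obtain ⟨l, hl', hl⟩ := h2.resolve_left (not_not.2 (Set.mem_univ j))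
    refine hτ.2 ⟨i, j, fun e => hadj.1 (Subtype.ext e), ?_, ?_⟩
    · rw [hinv i i.2, show τ i = k from rfl']
      exact Or.inl hk.2.2
    · rw [hinv j j.2, show τ j = l from hl']
      exact Or.inl hl.2.2

theorem IsStablePartition.verts_eq_univ (hσ : I.IsStablePartition σ)
    {M : (I.derived σ).acceptable.Subgraph} (hM : (I.derived σ).IsStableMatching M) :
    M.verts = Set.univ := by
  obtain ⟨τ, hτ, hττ⟩ := hσ.exists_reduced
  obtain ⟨N, hN, hNv, -⟩ := hσ.exists_isStableMatching hτ fun a ha => (hττ a ha).1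
  exact hM.verts_eq_univ hN hNv

/-- A stable matching of the derived instance extends by the odd cycles to a stable partition. -/
theorem IsStablePartition.exists_extension (hσ : I.IsStablePartition σ)
    {M : (I.derived σ).acceptable.Subgraph} (hM : (I.derived σ).IsStableMatching M) :
    ∃ τ, I.IsStablePartition τ ∧ ∀ a b, M.Adj a b → τ a = b := by
  classical
  have hv := hσ.verts_eq_univ hM
  have hm : ∀ a, ∃ b, M.Adj a b := fun a => (hM.1 (hv ▸ Set.mem_univ a)).exists
  choose m hm using hm
  have hmu : ∀ {a b}, M.Adj a b → m a = b := fun {a b} h => hM.1.eq_of_adj_left (hm a) h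
  have hmm : ∀ a, m (m a) = a := fun a => hmu (hm a).symm
  let s : A → A := fun a => if h : a ∉ oddAgents σ then m ⟨a, h⟩ else σ a
  have hs1 : ∀ a ∈ oddAgents σ, s a = σ a := fun a ha => by simp [s, ha]
  have hs2 : ∀ a : {a // a ∉ oddAgents σ}, s a = m a := fun a => by simp [s, a.2]
  have hinj : Function.Injective s := by
    intro a b h
    by_cases ha : a ∈ oddAgents σ <;> by_cases hb : b ∈ oddAgents σ
    · rw [hs1 a ha, hs1 b hb] at h
      exact σ.injective h
    · rw [hs1 a ha, hs2 ⟨b, hb⟩] at h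
      exact absurd (h ▸ apply_mem_oddAgents_iff.2 ha) (m ⟨b, hb⟩).2
    · rw [hs1 b hb, hs2 ⟨a, ha⟩] at h
      exact absurd (h ▸ apply_mem_oddAgents_iff.2 hb) (m ⟨a, ha⟩).2
    · rw [hs2 ⟨a, ha⟩, hs2 ⟨b, hb⟩] at h
      have := congrArg m (Subtype.ext h)
      rw [hmm, hmm] at this
      exact congrArg Subtype.val this
  let τ : Equiv.Perm A := Equiv.ofBijective s (Finite.injective_iff_bijective.1 hinj)
  have hτ : ∀ a, τ a = s a := fun a => rfl
  have hτ1 : ∀ a ∈ oddAgents σ, τ⁻¹ a = σ⁻¹ a := by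
    intro a ha
    rw [Equiv.Perm.inv_eq_iff_eq, hτ, hs1 _ (inv_apply_mem_oddAgents_iff.2 ha)]
    simp
  have hτ2 : ∀ a : {a // a ∉ oddAgents σ}, τ⁻¹ (a : A) = m a := by
    intro a
    rw [Equiv.Perm.inv_eq_iff_eq, hτ, hs2, hmm]
  have hpref : ∀ (a : {a // a ∉ oddAgents σ}) (b : A), I.PrefersExt a b (τ⁻¹ (a : A)) →
      I.prefers a b (m a) := by
    intro a b h
    rw [hτ2] at h
    exact (I.prefersExt_iff_prefers fun e => (hm a).adj_sub.ne (Subtype.ext e.symm)).1 h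
  -- Truncation exists for this: an odd-cycle agent and a matched agent cannot block, since the
  -- partner of `j` was not cut from its list.
  have hmixed : ∀ i ∈ oddAgents σ, ∀ j : {a // a ∉ oddAgents σ},
      I.PrefersExt i j (σ⁻¹ i) → ¬ I.prefers j i (m j) := fun i hi j h1 h2 =>
    (hm j).adj_sub.2.1 ⟨i, hi, h1, h2⟩
  refine ⟨τ, ⟨fun a => ?_, ?_⟩, fun a b hab => by rw [hτ, hs2, hmu hab]⟩
  · by_cases ha : a ∈ oddAgents σ
    · rw [hτ1 a ha, hτ, hs1 a ha]
      exact hσ.1 a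
    · left
      rw [hτ2 ⟨a, ha⟩, hτ, hs2 ⟨a, ha⟩]
  · rintro ⟨i, j, hij, h1, h2⟩
    by_cases hi : i ∈ oddAgents σ <;> by_cases hj : j ∈ oddAgents σ
    · rw [hτ1 _ hi] at h1
      rw [hτ1 _ hj] at h2
      exact hσ.2 ⟨i, j, hij, h1, h2⟩
    · rw [hτ1 _ hi] at h1
      exact hmixed i hi ⟨j, hj⟩ h1 (hpref ⟨j, hj⟩ i h2)
    · rw [hτ1 _ hj] at h2
      exact hmixed j hj ⟨i, hi⟩ h2 (hpref ⟨i, hi⟩ j h1)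
    · have p1 := hpref ⟨i, hi⟩ j h1
      have p2 := hpref ⟨j, hj⟩ i h2
      -- A blocking pair outside the odd cycles is mutually acceptable: an agent `k` truncating `j`
      -- from the list of `i` is preferred by `i` to `j`, hence to its partner, against `hmixed`.
      have t1 : ¬ I.Truncated σ i j := by
        rintro ⟨k, hk, k1, k2⟩
        exact hmixed k hk ⟨i, hi⟩ k1 (I.prefers_trans _ _ _ _ k2 p1)
      have t2 : ¬ I.Truncated σ j i := by
        rintro ⟨k, hk, k1, k2⟩
        exact hmixed k hk ⟨j, hj⟩ k1 (I.prefers_trans _ _ _ _ k2 p2)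
      have hne : (⟨i, hi⟩ : {a // a ∉ oddAgents σ}) ≠ ⟨j, hj⟩ := fun e =>
        hij (congrArg Subtype.val e)
      exact hM.2 ⟨i, hi⟩ ⟨j, hj⟩ ⟨⟨hne, t1, t2⟩,
        Or.inr ⟨_, hm _, ⟨⟨hne, t1, t2⟩, (hm _).adj_sub, p1⟩⟩,
        Or.inr ⟨_, hm _, ⟨⟨hne.symm, t2, t1⟩, (hm _).adj_sub, p2⟩⟩⟩

end SRInstance

/-! ### Counting reduced stable cycles. -/

theorem oddCycles_subset_image {A : Type*} (σ : Equiv.Perm A) :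
    oddCycles σ ⊆ Function.periodicOrbit σ '' oddAgents σ := by
  intro C hC
  obtain ⟨a, ha⟩ := hC.1.exists_mem
  exact ⟨a, ⟨C, hC, ha⟩, (hC.1.eq_periodicOrbit ha).symm⟩

/-- The cycle of length two on an unordered pair. -/
def Sym2.toCycle {A : Type*} : Sym2 A → Cycle A :=
  Sym2.lift ⟨fun a b => ↑[a, b], fun _ _ => Cycle.coe_eq_coe.2 ⟨1, rfl⟩⟩

theorem Sym2.toCycle_mk {A : Type*} (a b : A) : s(a, b).toCycle = ↑[a, b] := rfl

theorem Sym2.toCycle_injective {A : Type*} : Function.Injective (Sym2.toCycle (A := A)) := by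
  intro e f
  induction e with | _ a b
  induction f with | _ c d
  intro h
  rw [Sym2.toCycle_mk, Sym2.toCycle_mk, Cycle.coe_eq_coe] at h
  obtain ⟨n, hn, h⟩ := List.isRotated_iff_mod.1 h
  rw [Sym2.eq_iff]
  simp only [List.length_cons, List.length_nil] at hn
  interval_cases n <;> simp at h <;> tauto

theorem Cycle.exists_eq_pair_of_length_eq_two {A : Type*} {C : Cycle A} (h : C.length = 2) :
    ∃ a b : A, C = ↑[a, b] := by
  induction C using Quotient.inductionOn' with
  | h L =>
    obtain ⟨a, b, rfl⟩ := List.length_eq_two.1 (show L.length = 2 from h)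
    exact ⟨a, b, rfl⟩

namespace SRInstance

variable {A : Type*} [Finite A] {I : SRInstance A} {σ : Equiv.Perm A}

theorem IsStablePartition.reducedStableCycles_eq (hσ : I.IsStablePartition σ) :
    I.reducedStableCycles = oddCycles σ ∪
      (fun e : Sym2 {a // a ∉ oddAgents σ} => (e.map Subtype.val).toCycle) ''
        (I.derived σ).stablePairs := by
  ext C
  constructor
  · rintro ⟨⟨τ, hτ, hC⟩, hlen⟩
    by_cases hodd : Odd C.length
    · left
      rw [hσ.oddCycles_eq hτ]
      exact ⟨hC, hodd⟩
    right
    replace hlen := hlen.resolve_right hodd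
    obtain ⟨a, b, rfl⟩ := Cycle.exists_eq_pair_of_length_eq_two hlen
    obtain ⟨hab, h1, h2⟩ := isCycleOfPerm_pair.1 hC
    have hnot : ∀ x ∈ ((↑[a, b] : Cycle A)), x ∉ oddAgents σ := by
      rw [hσ.oddAgents_eq hτ]
      rintro x hx ⟨D, ⟨hD, hDodd⟩, hxD⟩
      rw [hD.eq_periodicOrbit hxD, ← hC.eq_periodicOrbit hx] at hDodd
      exact hodd hDodd
    have ha := hnot a (by simp)
    have hb := hnot b (by simp)
    -- Splitting the even cycles of `τ` keeps the transposition, since both neighbours of `a` are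
    -- `b`.
    obtain ⟨ρ, hρ, hρρ⟩ := hτ.exists_reduced
    rw [← hσ.oddAgents_eq hτ] at hρρ
    obtain ⟨M, hM, -, hadj⟩ := hσ.exists_isStableMatching hρ fun a ha => (hρρ a ha).1
    refine ⟨s(⟨a, ha⟩, ⟨b, hb⟩), ⟨M, hM, ?_⟩, rfl⟩
    rw [SimpleGraph.Subgraph.mem_edgeSet, hadj]
    rcases (hρρ a ha).2 with h | h
    · exact h.trans h1
    · rw [h, Equiv.Perm.inv_eq_iff_eq, h2]
  · rintro (⟨hC, hodd⟩ | ⟨e, ⟨M, hM, he⟩, rfl⟩)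
    · exact ⟨⟨σ, hσ, hC⟩, Or.inr hodd⟩
    · induction e with | _ a b
      obtain ⟨τ, hτ, hadj⟩ := hσ.exists_extension hM
      refine ⟨⟨τ, hτ, isCycleOfPerm_pair.2 ⟨fun h => ?_, hadj _ _ he, hadj _ _ he.symm⟩⟩,
        Or.inl rfl⟩
      exact he.adj_sub.ne (Subtype.ext h)

theorem IsStablePartition.ncard_reducedStableCycles (hσ : I.IsStablePartition σ) :
    I.reducedStableCycles.ncard = (oddCycles σ).ncard + (I.derived σ).stablePairs.ncard := by
  rw [hσ.reducedStableCycles_eq, Set.ncard_union_eq ?_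
    ((Set.toFinite _).subset (oddCycles_subset_image σ)) (Set.toFinite _),
    Set.ncard_image_of_injective]
  · exact Sym2.toCycle_injective.comp (Sym2.map.injective Subtype.val_injective)
  · rw [Set.disjoint_left]
    rintro _ ⟨-, hodd⟩ ⟨e, -, rfl⟩
    induction e with | _ a b
    exact absurd hodd (by change ¬ Odd 2; decide)

theorem ncard_stablePairs_le {B : Type*} [Finite B] (J : SRIInstance B) :
    J.stablePairs.ncard ≤ (Nat.card B).choose 2 := by
  classical
  have := Fintype.ofFinite B
  have h : J.stablePairs ⊆ {e | ¬ e.IsDiag} := by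
    rintro e ⟨M, -, he⟩
    exact J.acceptable.not_isDiag_of_mem_edgeSet (M.edgeSet_subset he)
  refine (Set.ncard_le_ncard h).trans (le_of_eq ?_)
  rw [Nat.card_eq_fintype_card, ← Sym2.card_subtype_not_diag, ← Nat.card_eq_fintype_card]
  rfl

theorem reducedStableCycles_nonempty [Nonempty A] (I : SRInstance A) :
    I.reducedStableCycles.Nonempty := by
  obtain ⟨σ, hσ⟩ := I.exists_isStablePartition
  obtain ⟨a⟩ := ‹Nonempty A›
  by_cases ha : a ∈ oddAgents σ
  · obtain ⟨C, hC, -⟩ := ha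
    exact ⟨C, ⟨σ, hσ, hC.1⟩, Or.inr hC.2⟩
  · obtain ⟨τ, hτ, hττ⟩ := hσ.exists_reduced
    refine ⟨↑[a, τ a], ⟨τ, hτ, isCycleOfPerm_pair.2 ⟨?_, rfl, (hττ a ha).1⟩⟩, Or.inl rfl⟩
    rw [hσ.oddAgents_eq hτ] at ha
    exact (apply_ne_of_notMem_oddAgents ha).symm

end SRInstance

/-- Here `m` counts the odd-cycle agents, which bound the odd cycles, and `k` the others. One more
odd-cycle agent adds 1 on the left and the old total on the right; the summand 1 is needed for `m =
2`, `k = 0`. -/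
theorem add_choose_two_le {m k : ℕ} (h : 2 ≤ m + k) :
    m + k.choose 2 ≤ (m + k) * (m + k - 1) / 2 + 1 := by
  rw [← Nat.choose_two_right]
  induction m with
  | zero => simp
  | succ m ih =>
    rw [show m + 1 + k = (m + k) + 1 by omega, Nat.choose_succ_succ' (m + k) 1, Nat.choose_one_right,
      show 1 + 1 = 2 from rfl]
    by_cases h2 : 2 ≤ m + k
    · have := ih h2
      omega
    · have : k.choose 2 = 0 := Nat.choose_eq_zero_of_lt (by omega)
      omega

theorem mainTheorem2 {A : Type*} [Fintype A] (I : SRInstance A) (hn : 2 ≤ Fintype.card A) :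
    1 ≤ I.reducedStableCycles.ncard ∧
    (∀ σ : Equiv.Perm A, I.IsStablePartition σ →
      I.reducedStableCycles.ncard = (oddCycles σ).ncard + (I.derived σ).stablePairs.ncard) ∧
    I.reducedStableCycles.ncard ≤ Fintype.card A * (Fintype.card A - 1) / 2 + 1 := by
  have : Nonempty A := Fintype.card_pos_iff.1 (by omega)
  obtain ⟨σ, hσ⟩ := I.exists_isStablePartition
  have hfin : I.reducedStableCycles.Finite := by
    rw [hσ.reducedStableCycles_eq]
    exact ((Set.toFinite _).subset (oddCycles_subset_image σ)).union (Set.toFinite _)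
  refine ⟨(Set.ncard_pos hfin).2 I.reducedStableCycles_nonempty,
    fun σ hσ => hσ.ncard_reducedStableCycles, ?_⟩
  rw [hσ.ncard_reducedStableCycles]
  have h1 : (oddCycles σ).ncard ≤ (oddAgents σ).ncard :=
    (Set.ncard_le_ncard (oddCycles_subset_image σ) (Set.toFinite _)).trans
      (Set.ncard_image_le (Set.toFinite _))
  have h2 := SRInstance.ncard_stablePairs_le (I.derived σ)
  have h3 : (oddAgents σ).ncard + Nat.card {a // a ∉ oddAgents σ} = Fintype.card A := by
    rw [← Nat.card_eq_fintype_card, ← Set.ncard_add_ncard_compl (oddAgents σ)]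
    rfl
  have h4 := add_choose_two_le (h3.symm ▸ hn)
  rw [h3] at h4
  omega
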